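/- Let $\mathbb D$ be the open unit disk, let $dA$ be the normalized area measure on $\mathbb D$, and let $A^2$ be the Bergman space, i.e. the closed subspace of analytic functions in $L^2(\mathbb D,dA)$, with standard orthonormal base $e_n(z)=\sqrt{n+1}\,z^n$ ($n\ge 0$). For $a\in L^\infty(\mathbb D)$ let $T_a$ be the Toeplitz operator on $A^2$ with symbol $a$, $$T_af(z)=\int_{\mathbb D}\frac{a(w)f(w)}{(1-\overline{w}z)^2}\,dA(w)\qquad (f\in A^2,\ z\in\mathbb D),$$ and let the Toeplitz algebra $\mathfrak T$ be the closed subalgebra (in operator norm) of the bounded operators on $A^2$ generated by $\{T_a : a\in L^\infty(\mathbb D)\}$. A bounded operator $S$ on $A^2$ is called radial if it is diagonal with respect to the standard base, i.e. $Se_n=\lambda_ne_n$ for all $n\ge0$ with some $\lambda_n\in\mathbb C$. The essential spectrum $\sigma_e(S)$ is the set of $z\in\mathbb C$ for which $S-zI$ is not a Fredholm operator. Let $E\subset\mathbb C$ be a nonempty, compact, connected set. Then there is a radial operator $S\in\mathfrak T$ such that $\sigma_e(S)=E$. -/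

import Mathlib

open MeasureTheory
open scoped ComplexConjugate ENNReal

noncomputable section

/-- Normalized area measure `dA` on the open unit disk: Lebesgue measure of the plane restricted to
the disk, divided by `π`. -/
def diskArea : Measure ℂ :=
  ENNReal.ofReal Real.pi⁻¹ • (volume : Measure ℂ).restrict (Metric.ball 0 1)

instance : IsFiniteMeasure diskArea := by
  constructor
  simp only [diskArea, Measure.smul_apply, Measure.restrict_apply_univ, smul_eq_mul]
  exact ENNReal.mul_lt_top ENNReal.ofReal_lt_top measure_ball_lt_top

lemma ae_diskArea_mem : ∀ᵐ z ∂diskArea, z ∈ Metric.ball (0 : ℂ) 1 :=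
  Measure.ae_smul_measure (ae_restrict_mem measurableSet_ball) _

/-- The subspace of `L²(𝔻, dA)` formed by the (classes of) functions that are analytic in the open
unit disk. -/
def bergmanSubmodule : Submodule ℂ (Lp ℂ 2 diskArea) where
  carrier := {f | ∃ g : ℂ → ℂ, DifferentiableOn ℂ g (Metric.ball 0 1) ∧ f =ᵐ[diskArea] g}
  zero_mem' := ⟨0, differentiableOn_const 0, Lp.coeFn_zero ℂ 2 diskArea⟩
  add_mem' := by
    rintro f₁ f₂ ⟨g₁, hg₁, h₁⟩ ⟨g₂, hg₂, h₂⟩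
    exact ⟨g₁ + g₂, hg₁.add hg₂, (Lp.coeFn_add f₁ f₂).trans (h₁.add h₂)⟩
  smul_mem' := by
    rintro c f ⟨g, hg, h⟩
    exact ⟨c • g, hg.const_smul c, (Lp.coeFn_smul c f).trans (h.const_smul c)⟩

/-- The Bergman space `A²`: the analytic functions in `L²(𝔻, dA)`, with the norm and the inner
product of `L²(𝔻, dA)`. -/
def Bergman : Type := bergmanSubmodule

namespace Bergman

instance : NormedAddCommGroup Bergman := inferInstanceAs (NormedAddCommGroup bergmanSubmodule)

instance : InnerProductSpace ℂ Bergman := inferInstanceAs (InnerProductSpace ℂ bergmanSubmodule)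

/-- The inclusion of `A²` in `L²(𝔻, dA)`. -/
def incl : Bergman →ₗᵢ[ℂ] Lp ℂ 2 diskArea := bergmanSubmodule.subtypeₗᵢ

instance : CoeFun Bergman (fun _ => ℂ → ℂ) := ⟨fun f => incl f⟩

end Bergman

lemma memLp_basisFun (n : ℕ) :
    MemLp (fun z : ℂ => (Real.sqrt (n + 1) : ℂ) * z ^ n) 2 diskArea := by
  refine MemLp.of_bound (by fun_prop) (Real.sqrt (n + 1)) ?_
  filter_upwards [ae_diskArea_mem] with z hz
  rw [norm_mul, norm_pow, Complex.norm_real, Real.norm_of_nonneg (Real.sqrt_nonneg _)]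
  exact mul_le_of_le_one_right (Real.sqrt_nonneg _)
    (pow_le_one₀ (norm_nonneg z) (mem_ball_zero_iff.mp hz).le)

/-- The standard orthonormal base of `A²`: `eₙ(z) = √(n + 1) zⁿ`. -/
def bergmanBasis (n : ℕ) : Bergman :=
  ⟨(memLp_basisFun n).toLp _, _, by fun_prop, (memLp_basisFun n).coeFn_toLp⟩

/-- `T` is the Toeplitz operator `T_a` with symbol `a ∈ L^∞(𝔻)`:
`(T f)(z) = ∫ a(w) f(w) / (1 - w̄ z)² dA(w)` for all `f ∈ A²`. As `T` takes values in `A²`, the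
bounded operator `T` is determined by `a`. Both sides are (a.e. equal to) analytic functions of `z`
in the disk, so equality for almost every `z` is equality for every `z` in the disk. -/
def IsToeplitz (a : Lp ℂ ∞ diskArea) (T : Bergman →L[ℂ] Bergman) : Prop :=
  ∀ f : Bergman, T f =ᵐ[diskArea] fun z => ∫ w, a w * f w / (1 - conj w * z) ^ 2 ∂diskArea

/-- The Toeplitz algebra `𝔗`: the operator-norm closed subalgebra of the bounded operators on `A²`
generated by the Toeplitz operators with symbols in `L^∞(𝔻)`. -/
def toeplitzAlgebra : Subalgebra ℂ (Bergman →L[ℂ] Bergman) :=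
  (Algebra.adjoin ℂ {T | ∃ a : Lp ℂ ∞ diskArea, IsToeplitz a T}).topologicalClosure

/-- Radial operators: those that are diagonal with respect to the standard base. -/
def IsRadial (S : Bergman →L[ℂ] Bergman) : Prop :=
  ∃ c : ℕ → ℂ, ∀ n, S (bergmanBasis n) = c n • bergmanBasis n

/-- The essential spectrum of a bounded operator: the `z` for which `S - z` is not Fredholm. -/
def essentialSpectrum (S : Bergman →L[ℂ] Bergman) : Set ℂ :=
  {z | ¬ (S - z • ContinuousLinearMap.id ℂ Bergman).IsFredholm}

end

/-!
The operator is a single Toeplitz operator `T_a` with radial symbol, so that membership in the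
Toeplitz algebra is immediate.

A connected set `E` can be traversed by a sequence `p` of its points whose steps tend to zero and
which accumulates at every point of `E` (`IsConnected.exists_seq_slow`). Take
`a(w) = p ⌊√(-log (-log |w|))⌋₊`. Because `a` is radial, `T_a` is diagonal in the standard base, and
after a change of variables its `n`-th eigenvalue is `∫₀¹ a(t ^ (1 / (2n + 2))) dt`
(`toeplitz_radial_bergmanBasis`). Here the argument of the square root becomes
`log (2n + 2) - log (-log t)`; as the step function `x ↦ p ⌊√x⌋₊` varies slowly, dominated
convergence shows that the eigenvalues differ from `p ⌊√(log (2n + 2))⌋₊` by a null sequence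
(`tendsto_integral_slow_sub`). That sequence runs slowly through all the `p k`, so the cluster points
of the eigenvalues are exactly the points of the closed set `E`.

It remains to know that the essential spectrum of a diagonal operator is the set of cluster points
of its diagonal (`not_isFredholm_sub_smul_id_iff`): away from them the reciprocal entries, cut off at
finitely many indices, give a quasi-inverse, and at a cluster point the operator is arbitrarily small
on infinite-dimensional spans of basis vectors.

The Hilbert space input is that the standard base is a Hilbert basis of a closed subspace of
`L²(𝔻, dA)`, and that the orthogonal projection onto it is integration against the kernel
`(1 - w̄ z)⁻²`. Everything follows from the expansion of the kernel integral of `f` as a power series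
with the moments `∫ w̄ ^ n f(w) dA(w)` as coefficients (`hasSum_bergmanIntegral`), together with the
computation of these moments for analytic `f` (`diskMoment_of_hasSum`): the Bergman space consists of
the `f` that agree almost everywhere with their kernel integral.
-/

open Filter Topology

/-! ### Slow sequences in connected sets -/

/-- Any two points of a connected set are joined by a chain of small steps inside the set: the points
reachable from `x` form a nonempty clopen subset. -/
lemma IsPreconnected.exists_chain {X : Type*} [PseudoMetricSpace X] {E : Set X}
    (hE : IsPreconnected E) {x y : X} (hx : x ∈ E) (hy : y ∈ E) {ε : ℝ} (hε : 0 < ε) :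
    ∃ (N : ℕ) (f : ℕ → X), (∀ i, f i ∈ E) ∧ f 0 = x ∧ f N = y ∧
      ∀ i < N, dist (f i) (f (i + 1)) < ε := by
  have : PreconnectedSpace E := Subtype.preconnectedSpace hE
  let s : Set E := {y | ∃ (N : ℕ) (f : ℕ → X), (∀ i, f i ∈ E) ∧ f 0 = x ∧ f N = y ∧
      ∀ i < N, dist (f i) (f (i + 1)) < ε}
  have step : ∀ u ∈ s, ∀ v : E, dist u v < ε → v ∈ s := by
    rintro u ⟨N, f, hf, h0, hN, hd⟩ v huv
    refine ⟨N + 1, fun i => if i ≤ N then f i else v, fun i => ?_, by simpa using h0, by simp,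
      fun i hi => ?_⟩
    · dsimp only
      split_ifs
      exacts [hf i, v.2]
    · rcases Nat.lt_succ_iff_lt_or_eq.mp hi with h | rfl
      · simpa [h.le, Nat.succ_le_of_lt h] using hd i h
      · simpa [hN, Subtype.dist_eq] using huv
  have hclopen : IsClopen s := by
    constructor
    · rw [← isOpen_compl_iff, Metric.isOpen_iff]
      refine fun u hu => ⟨ε, hε, fun v hv hvs => hu (step v hvs u hv)⟩
    · rw [Metric.isOpen_iff]
      exact fun u hu => ⟨ε, hε, fun v hv => step u hu v (by rwa [dist_comm])⟩
  have huniv : s = Set.univ :=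
    hclopen.eq_univ ⟨⟨x, hx⟩, 0, fun _ => x, fun _ => hx, rfl, rfl, by simp⟩
  exact (huniv ▸ Set.mem_univ (⟨y, hy⟩ : E) : (⟨y, hy⟩ : E) ∈ s)

/-- The successor of `s` among the pairs `(m, j)` with `j ≤ N m` in lexicographic order. -/
def lexStep (N : ℕ → ℕ) (s : ℕ × ℕ) : ℕ × ℕ :=
  if s.2 < N s.1 then (s.1, s.2 + 1) else (s.1 + 1, 0)

/-- The enumeration of the pairs `(m, j)` with `j ≤ N m` in lexicographic order, starting at
`(0, 0)`. -/
def lexSeq (N : ℕ → ℕ) (k : ℕ) : ℕ × ℕ := (lexStep N)^[k] (0, 0)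

lemma lexSeq_succ (N : ℕ → ℕ) (k : ℕ) : lexSeq N (k + 1) = lexStep N (lexSeq N k) :=
  Function.iterate_succ_apply' _ _ _

lemma monotone_lexSeq_fst (N : ℕ → ℕ) : Monotone fun k => (lexSeq N k).1 := by
  refine monotone_nat_of_le_succ fun k => ?_
  rw [lexSeq_succ, lexStep]
  split_ifs <;> simp

lemma exists_lexSeq_eq (N : ℕ → ℕ) (m : ℕ) {j : ℕ} (hj : j ≤ N m) : ∃ k, lexSeq N k = (m, j) := by
  have fill : ∀ m, (∃ k, lexSeq N k = (m, 0)) → ∀ j ≤ N m, ∃ k, lexSeq N k = (m, j) := by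
    intro m h0 j
    induction j with
    | zero => exact fun _ => h0
    | succ j ih =>
      intro hj
      obtain ⟨k, hk⟩ := ih (by omega)
      exact ⟨k + 1, by rw [lexSeq_succ, hk, lexStep, if_pos (by simpa using hj)]⟩
  refine fill m ?_ j hj
  induction m generalizing j with
  | zero => exact ⟨0, rfl⟩
  | succ m ih =>
    obtain ⟨k, hk⟩ := fill m (ih le_rfl) (N m) le_rfl
    exact ⟨k + 1, by rw [lexSeq_succ, hk, lexStep, if_neg (by simp)]⟩

lemma tendsto_lexSeq_fst (N : ℕ → ℕ) : Tendsto (fun k => (lexSeq N k).1) atTop atTop := by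
  refine tendsto_atTop_atTop_of_monotone (monotone_lexSeq_fst N) fun m => ?_
  obtain ⟨k, hk⟩ := exists_lexSeq_eq N m (Nat.zero_le _)
  exact ⟨k, by simp [hk]⟩

/-- A connected set in a separable space is traversed by a sequence with steps tending to zero
that comes back near each of its points infinitely often. The sequence concatenates finer and finer
chains between the successive terms of a sequence in which each member of a countable dense set
occurs infinitely often. -/
lemma IsConnected.exists_seq_slow {X : Type*} [PseudoMetricSpace X]
    [SecondCountableTopology X] {E : Set X} (hE : IsConnected E) :
    ∃ p : ℕ → X, (∀ k, p k ∈ E) ∧ Tendsto (fun k => dist (p k) (p (k + 1))) atTop (𝓝 0) ∧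
      ∀ x ∈ E, MapClusterPt x atTop p := by
  have : Nonempty E := hE.nonempty.to_subtype
  obtain ⟨d, hd⟩ := TopologicalSpace.exists_dense_seq E
  let t : ℕ → E := fun m => d m.unpair.1
  have hε : ∀ m : ℕ, (0 : ℝ) < 1 / ((m : ℝ) + 1) := fun m => Nat.one_div_pos_of_nat
  choose N f hfE hf0 hfN hfd using fun m : ℕ =>
    hE.isPreconnected.exists_chain (t m).2 (t (m + 1)).2 (hε m)
  let p : ℕ → X := fun k => f (lexSeq N k).1 (lexSeq N k).2
  have hle : ∀ k, (lexSeq N k).2 ≤ N (lexSeq N k).1 := by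
    intro k
    induction k with
    | zero => exact Nat.zero_le _
    | succ k ih =>
      rw [lexSeq_succ, lexStep]
      split_ifs with h
      · exact h
      · exact Nat.zero_le _
  refine ⟨p, fun k => hfE _ _, ?_, fun x hx => ?_⟩
  · refine squeeze_zero (fun _ => dist_nonneg) (fun k => ?_)
      ((tendsto_one_div_add_atTop_nhds_zero_nat (𝕜 := ℝ)).comp (tendsto_lexSeq_fst N))
    simp only [p, lexSeq_succ, lexStep, Function.comp_apply]
    split_ifs with h
    · exact (hfd _ _ h).le
    · -- the end of a chain is the start of the next one, so the sequence pauses for one step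
      have : (lexSeq N k).2 = N (lexSeq N k).1 := le_antisymm (hle k) (not_lt.mp h)
      rw [this, hfN, hf0, dist_self]
      exact (hε _).le
  · rw [mapClusterPt_iff_frequently]
    intro s hs
    rw [frequently_atTop]
    intro K
    obtain ⟨i, hi⟩ := hd.exists_mem_open
      (isOpen_interior.preimage continuous_subtype_val) ⟨⟨x, hx⟩, mem_interior_iff_mem_nhds.mpr hs⟩
    -- the stage `Nat.pair i m` starts at `d i`, and it is not reached before time `K`
    set m := Nat.pair i ((lexSeq N K).1 + 1) with hm
    obtain ⟨k, hk⟩ := exists_lexSeq_eq N m (Nat.zero_le _)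
    refine ⟨k, ?_, ?_⟩
    · by_contra! hlt
      have h1 : (lexSeq N k).1 ≤ (lexSeq N K).1 := monotone_lexSeq_fst N hlt.le
      have h2 : (lexSeq N K).1 + 1 ≤ m := Nat.right_le_pair _ _
      rw [hk] at h1
      simp only at h1
      omega
    · have : p k = d i := by simp [p, hk, hf0, t, hm]
      rw [this]
      exact interior_subset hi

/-! ### Fredholm properties of diagonal operators -/

namespace HilbertBasis

variable {ι H : Type*} [NormedAddCommGroup H] [InnerProductSpace ℂ H]

lemma ext_repr (b : HilbertBasis ι ℂ H) {x y : H} (h : ∀ i, b.repr x i = b.repr y i) : x = y :=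
  b.repr.injective (by ext i; exact h i)

lemma hasSum_norm_sq_repr (b : HilbertBasis ι ℂ H) (x : H) :
    HasSum (fun i => ‖b.repr x i‖ ^ 2) (‖x‖ ^ 2) := by
  have := lp.hasSum_norm (p := 2) (by simp) (b.repr x)
  simpa using this

lemma repr_map_eq_mul (b : HilbertBasis ι ℂ H) {T : H →L[ℂ] H} {c : ι → ℂ}
    (hT : ∀ i, T (b i) = c i • b i) (x : H) (i : ι) :
    b.repr (T x) i = c i * b.repr x i := by
  classical
  have h1 : HasSum (fun j => inner ℂ (b i) (T (b.repr x j • b j))) (inner ℂ (b i) (T x)) :=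
    (b.hasSum_repr x).mapL ((innerSL ℂ (b i)).comp T)
  rw [b.repr_apply_apply]
  refine h1.unique ?_
  convert! hasSum_ite_eq i (c i * b.repr x i) using 2 with j
  rw [map_smul, hT, inner_smul_right, inner_smul_right, orthonormal_iff_ite.mp b.orthonormal]
  by_cases hij : i = j
  · subst hij; simp [mul_comm]
  · simp [hij, Ne.symm hij]

/-- The bounded operator that is diagonal in the Hilbert basis `b`, with the entries of the bounded
family `d` on the diagonal. -/
noncomputable def diagonal (b : HilbertBasis ι ℂ H) (d : lp (fun _ : ι => ℂ) ∞) : H →L[ℂ] H :=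
  (b.repr.symm : lp (fun _ : ι => ℂ) 2 →L[ℂ] H) ∘L
    lp.holderL (K := 1) 2 (fun _ => ContinuousLinearMap.mul ℂ ℂ)
      (fun _ => by simp) d ∘L
    (b.repr : H →L[ℂ] lp (fun _ : ι => ℂ) 2)

lemma repr_diagonal (b : HilbertBasis ι ℂ H) (d : lp (fun _ : ι => ℂ) ∞) (x : H) (i : ι) :
    b.repr (b.diagonal d x) i = d i * b.repr x i := by
  simp [diagonal, lp.holderL]

end HilbertBasis

section Diagonal

open LinearMap.FiniteRangeSetoid

variable {H : Type*} [NormedAddCommGroup H] [InnerProductSpace ℂ H]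

/-- The vectors whose first `N` coordinates vanish form a subspace of finite codimension. -/
lemma HilbertBasis.exists_coFG_repr_eq_zero (b : HilbertBasis ℕ ℂ H) (N : ℕ) :
    ∃ A : Submodule ℂ H, A.CoFG ∧ ∀ x ∈ A, ∀ n < N, b.repr x n = 0 := by
  let f : H →ₗ[ℂ] (Fin N → ℂ) :=
    LinearMap.pi fun n => (innerSL ℂ (b n)).toLinearMap
  refine ⟨f.ker, LinearMap.ker_coFG_iff_hasFiniteRange.mpr (by simp), fun x hx n hn => ?_⟩
  rw [b.repr_apply_apply]
  exact congrFun (LinearMap.mem_ker.mp hx) ⟨n, hn⟩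

/-- The operator with the reciprocal entries, cut off where the entries are small, is a
quasi-inverse. -/
lemma isFredholm_of_diagonal (b : HilbertBasis ℕ ℂ H) {T : H →L[ℂ] H} {c : ℕ → ℂ}
    (hT : ∀ n, T (b n) = c n • b n) {δ : ℝ} (hδ : 0 < δ) (hc : ∀ᶠ n in atTop, δ ≤ ‖c n‖) :
    T.IsFredholm := by
  obtain ⟨N, hN⟩ := eventually_atTop.mp hc
  let d : lp (fun _ : ℕ => ℂ) ∞ :=
    ⟨fun n => if N ≤ n then (c n)⁻¹ else 0, memℓp_infty ⟨δ⁻¹, by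
      rintro _ ⟨n, rfl⟩
      dsimp only
      split_ifs with h
      · rw [norm_inv]
        exact inv_anti₀ hδ (hN n h)
      · simpa using hδ.le⟩⟩
  have hcd : ∀ n, N ≤ n → d n * c n = 1 := fun n hn => by
    have : c n ≠ 0 := norm_pos_iff.mp (hδ.trans_le (hN n hn))
    change (if N ≤ n then (c n)⁻¹ else 0) * c n = 1
    rw [if_pos hn, inv_mul_cancel₀ this]
  obtain ⟨A, hA, hA0⟩ := b.exists_coFG_repr_eq_zero N
  have key : ∀ x ∈ A, ∀ n, d n * c n * b.repr x n = b.repr x n := by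
    intro x hx n
    rcases lt_or_ge n N with h | h
    · rw [hA0 x hx n h, mul_zero]
    · rw [hcd n h, one_mul]
  refine .of_isQuasiInverse (v := b.diagonal d) ⟨?_, ?_⟩
  · refine equiv_of_eqOn_coFG hA fun x hx => b.ext_repr fun n => ?_
    simp [b.repr_diagonal, b.repr_map_eq_mul hT, ← mul_assoc, key x hx]
  · refine equiv_of_eqOn_coFG hA fun x hx => b.ext_repr fun n => ?_
    simpa [b.repr_diagonal, b.repr_map_eq_mul hT, mul_assoc, mul_left_comm (c n)] using key x hx n

lemma norm_map_le_of_diagonal (b : HilbertBasis ℕ ℂ H) {T : H →L[ℂ] H} {c : ℕ → ℂ}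
    (hT : ∀ n, T (b n) = c n • b n) {ε : ℝ} (hε : 0 ≤ ε) {x : H}
    (hx : ∀ n, ‖c n‖ ≤ ε ∨ b.repr x n = 0) : ‖T x‖ ≤ ε * ‖x‖ := by
  refine abs_le_of_sq_le_sq' ?_ (by positivity) |>.2
  rw [mul_pow]
  refine hasSum_le (fun n => ?_) (b.hasSum_norm_sq_repr (T x))
    ((b.hasSum_norm_sq_repr x).mul_left (ε ^ 2))
  rw [b.repr_map_eq_mul hT, norm_mul, mul_pow]
  rcases hx n with h | h
  · gcongr
  · simp [h]

/-- An operator with arbitrarily small diagonal entries arbitrarily far out is not Fredholm: a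
left inverse modulo finite rank would be an exact left inverse on a nonzero combination of
basis vectors that the operator contracts too strongly. -/
lemma not_isFredholm_of_diagonal (b : HilbertBasis ℕ ℂ H) {T : H →L[ℂ] H} {c : ℕ → ℂ}
    (hT : ∀ n, T (b n) = c n • b n) (hc : ∀ ε > 0, ∃ᶠ n in atTop, ‖c n‖ ≤ ε) :
    ¬ T.IsFredholm := by
  intro hF
  obtain ⟨v, hv, -⟩ := hF.exists_isQuasiInverse
  have hA := equiv_iff_eqLocus_coFG.mp hv
  set A := LinearMap.eqLocus ((v : H →ₗ[ℂ] H) ∘ₗ (T : H →ₗ[ℂ] H)) LinearMap.id with hAdef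
  set ε : ℝ := (2 * (‖v‖ + 1))⁻¹ with hεdef
  have hε : 0 < ε := by positivity
  let s : Set ℕ := {n | ‖c n‖ ≤ ε}
  have hs : s.Infinite := Nat.frequently_atTop_iff_infinite.mp (hc ε hε)
  have : Infinite s := hs.to_subtype
  let f : (s →₀ ℂ) →ₗ[ℂ] H := Finsupp.linearCombination ℂ fun n : s => b n
  have hf : Function.Injective f :=
    (b.orthonormal.linearIndependent.comp _ Subtype.val_injective)
  have : Module.Finite ℂ (H ⧸ A) := hA
  -- an infinite-dimensional span meets the finite-codimensional space where `v ∘ T` is the identity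
  have hninj : ¬ Function.Injective (A.mkQ ∘ₗ f) := fun hinj => by
    have h1 : Module.Finite ℂ (s →₀ ℂ) := Module.Finite.of_injective _ hinj
    have h2 := (Finsupp.basisSingleOne (R := ℂ) (ι := s)).linearIndependent.finite
    exact not_finite s
  obtain ⟨g, hg, hg0⟩ : ∃ g, (A.mkQ ∘ₗ f) g = 0 ∧ g ≠ 0 := by
    by_contra! h
    exact hninj ((injective_iff_map_eq_zero _).mpr h)
  have hxA : f g ∈ A := by simpa using hg
  have hx0 : f g ≠ 0 := fun h => hg0 (hf (h.trans (map_zero f).symm))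
  have hvT : v (T (f g)) = f g := hxA
  have hrepr : ∀ n, ‖c n‖ ≤ ε ∨ b.repr (f g) n = 0 := by
    intro n
    by_cases hn : ‖c n‖ ≤ ε
    · exact Or.inl hn
    · right
      rw [b.repr_apply_apply, Finsupp.linearCombination_apply, Finsupp.sum, inner_sum]
      refine Finset.sum_eq_zero fun m _ => ?_
      have : n ≠ m := fun h => hn (h ▸ m.2)
      rw [inner_smul_right, b.orthonormal.2 this, mul_zero]
  have h1 := norm_map_le_of_diagonal b hT hε.le hrepr
  have h2 : ‖f g‖ ≤ ‖v‖ * (ε * ‖f g‖) := by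
    calc ‖f g‖ = ‖v (T (f g))‖ := by rw [hvT]
      _ ≤ ‖v‖ * ‖T (f g)‖ := v.le_opNorm _
      _ ≤ _ := by gcongr
  have h3 : 0 < ‖f g‖ := norm_pos_iff.mpr hx0
  have h4 : ‖v‖ * ε < 1 := by
    rw [hεdef, ← div_eq_mul_inv, div_lt_one (by positivity)]
    linarith [norm_nonneg v]
  nlinarith

/-- The operator with diagonal `c - z` fails to be Fredholm exactly when `z` is a cluster point of
`c`. -/
lemma not_isFredholm_sub_smul_id_iff (b : HilbertBasis ℕ ℂ H) {T : H →L[ℂ] H} {c : ℕ → ℂ}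
    (hT : ∀ n, T (b n) = c n • b n) (z : ℂ) :
    ¬ (T - z • ContinuousLinearMap.id ℂ H).IsFredholm ↔ MapClusterPt z atTop c := by
  have hTz : ∀ n, (T - z • ContinuousLinearMap.id ℂ H) (b n) = (c n - z) • b n := fun n => by
    simp [hT, sub_smul]
  constructor
  · intro h
    by_contra hcl
    refine h ?_
    rw [Metric.nhds_basis_ball.mapClusterPt_iff_frequently] at hcl
    push Not at hcl
    obtain ⟨δ, hδ, h⟩ := hcl
    refine isFredholm_of_diagonal b hTz hδ ?_
    filter_upwards [h] with n hn
    simpa [dist_eq_norm] using hn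
  · intro h
    refine not_isFredholm_of_diagonal b hTz fun ε hε => ?_
    refine (Metric.nhds_basis_ball.mapClusterPt_iff_frequently.mp h ε hε).mono fun n hn => ?_
    rw [← dist_eq_norm]
    exact (Metric.mem_ball.mp hn).le

end Diagonal

/-! ### Integration of radial functions over the disk -/

lemma integral_diskArea (f : ℂ → ℂ) :
    ∫ w, f w ∂diskArea = (Real.pi : ℂ)⁻¹ * ∫ w in Metric.ball 0 1, f w := by
  rw [diskArea, integral_smul_measure, ENNReal.toReal_ofReal (by positivity), Complex.real_smul,
    Complex.ofReal_inv]

lemma integral_diskArea_rotation (u : Circle) (f : ℂ → ℂ) :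
    ∫ w, f (u * w) ∂diskArea = ∫ w, f w ∂diskArea := by
  rw [integral_diskArea, integral_diskArea]
  congr 1
  have hmp : MeasurePreserving (rotation u) volume volume := (rotation u).measurePreserving
  have := hmp.setIntegral_preimage_emb
    (rotation u).toHomeomorph.measurableEmbedding f (Metric.ball 0 1)
  rw [← this]
  have hpre : rotation u ⁻¹' Metric.ball 0 1 = Metric.ball 0 1 := by
    ext w
    rw [Set.mem_preimage, mem_ball_zero_iff, mem_ball_zero_iff, LinearIsometryEquiv.norm_map]
  rw [hpre]
  simp only [rotation_apply]

lemma integral_diskArea_norm (F : ℝ → ℂ) :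
    ∫ w, F ‖w‖ ∂diskArea = 2 * ∫ y in Set.Ioo 0 1, y • F y := by
  rw [integral_diskArea]
  have h1 : ∫ w in Metric.ball (0 : ℂ) 1, F ‖w‖ = ∫ w : ℂ, (Set.Iio 1).indicator F ‖w‖ := by
    rw [← integral_indicator measurableSet_ball]
    congr 1 with w
    simp [Set.indicator]
  rw [h1, integral_fun_norm_addHaar]
  have h2 : ∫ y in Set.Ioi (0 : ℝ), y ^ (Module.finrank ℝ ℂ - 1) • (Set.Iio 1).indicator F y =
      ∫ y in Set.Ioo 0 1, y • F y := by
    rw [← Set.Ioi_inter_Iio, ← setIntegral_indicator measurableSet_Iio]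
    congr 1 with y
    simp [Set.indicator]
  rw [h2]
  have hvol : volume.real (Metric.ball (0 : ℂ) 1) = Real.pi := by
    simp [Measure.real, Complex.volume_ball]
  have hpi : (Real.pi : ℂ) ≠ 0 := by exact_mod_cast Real.pi_ne_zero
  rw [hvol, Complex.finrank_real_complex, nsmul_eq_mul, Complex.real_smul]
  push_cast
  field_simp

/-- Against a radial weight, distinct monomials are orthogonal: a suitable rotation changes
the sign of the integral. -/
lemma integral_radial_mul_monomial_of_ne (F : ℝ → ℂ) {m n : ℕ} (hmn : m ≠ n) :
    ∫ w, F ‖w‖ * (conj w ^ m * w ^ n) ∂diskArea = 0 := by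
  have hd : ((n : ℂ) - m) ≠ 0 := sub_ne_zero.mpr (by exact_mod_cast hmn.symm)
  let u : Circle := Circle.exp (Real.pi / ((n : ℝ) - m))
  have hu : conj (u : ℂ) ^ m * (u : ℂ) ^ n = -1 := by
    rw [← Circle.coe_inv_eq_conj, ← Circle.exp_neg, Circle.coe_exp, Circle.coe_exp,
      ← Complex.exp_nat_mul, ← Complex.exp_nat_mul, ← Complex.exp_add, ← Complex.exp_pi_mul_I]
    congr 1
    push_cast
    field_simp
    ring
  have h := integral_diskArea_rotation u fun w => F ‖w‖ * (conj w ^ m * w ^ n)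
  have h2 : ∀ w : ℂ, F ‖(u : ℂ) * w‖ * (conj ((u : ℂ) * w) ^ m * ((u : ℂ) * w) ^ n) =
      -(F ‖w‖ * (conj w ^ m * w ^ n)) := fun w => by
    rw [norm_mul, Circle.norm_coe, one_mul, map_mul, mul_pow, mul_pow]
    linear_combination F ‖w‖ * (conj w ^ m * w ^ n) * hu
  simp only [h2, integral_neg] at h
  exact self_eq_neg.mp h.symm

lemma integral_radial_mul_monomial_self (F : ℝ → ℂ) (n : ℕ) :
    ∫ w, F ‖w‖ * (conj w ^ n * w ^ n) ∂diskArea =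
      2 * ∫ y in Set.Ioo (0 : ℝ) 1, (y ^ (2 * n + 1) : ℝ) * F y := by
  have h : ∀ w : ℂ, F ‖w‖ * (conj w ^ n * w ^ n) =
      (fun y : ℝ => F y * ((y ^ (2 * n) : ℝ) : ℂ)) ‖w‖ := fun w => by
    dsimp only
    rw [← mul_pow, Complex.conj_mul', pow_mul]
    push_cast
    rfl
  rw [integral_congr_ae (Eventually.of_forall h),
    integral_diskArea_norm fun y : ℝ => F y * ((y ^ (2 * n) : ℝ) : ℂ)]
  congr 2 with y
  rw [Complex.real_smul]
  push_cast
  ring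

lemma integral_Ioo_pow (n : ℕ) {r : ℝ} (hr : 0 ≤ r) :
    ∫ y in Set.Ioo (0 : ℝ) r, ((y ^ n : ℝ) : ℂ) = (r ^ (n + 1) / (n + 1) : ℝ) := by
  rw [integral_complex_ofReal, ← integral_Ioc_eq_integral_Ioo, ← intervalIntegral.integral_of_le hr,
    integral_pow]
  simp

/-- The substitution `t = y ^ (2n + 2)`. -/
lemma integral_pow_mul_eq (F : ℝ → ℂ) (n : ℕ) :
    (2 * (n + 1) : ℂ) * ∫ y in Set.Ioo (0 : ℝ) 1, (y ^ (2 * n + 1) : ℝ) * F y =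
      ∫ t in Set.Ioo (0 : ℝ) 1, F (t ^ ((2 * n + 2 : ℝ)⁻¹)) := by
  have hp : (0 : ℝ) < 2 * n + 2 := by positivity
  have h := integral_comp_rpow_Ioi_of_pos
    (g := (Set.Iio (1 : ℝ)).indicator fun t => F (t ^ ((2 * n + 2 : ℝ)⁻¹))) hp
  rw [setIntegral_indicator measurableSet_Iio, Set.Ioi_inter_Iio] at h
  rw [← h, ← Set.Ioi_inter_Iio, ← setIntegral_indicator measurableSet_Iio, ← integral_const_mul]
  refine setIntegral_congr_fun measurableSet_Ioi fun y (hy : 0 < y) => ?_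
  have h1 : y ^ (2 * n + 2 : ℝ) < 1 ↔ y < 1 := Real.rpow_lt_one_iff_of_pos hy |>.trans (by
    constructor
    · rintro (h | h)
      · linarith
      · exact h.1
    · exact fun h => Or.inr ⟨h, hp⟩)
  by_cases hy1 : y < 1
  · rw [Set.indicator_of_mem (by exact hy1), Set.indicator_of_mem (by exact h1.mpr hy1),
      Real.rpow_rpow_inv hy.le hp.ne', Complex.real_smul]
    have : (2 * n + 2 : ℝ) - 1 = ((2 * n + 1 : ℕ) : ℝ) := by push_cast; ring
    rw [this, Real.rpow_natCast]
    push_cast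
    ring
  · rw [Set.indicator_of_notMem (by exact hy1), Set.indicator_of_notMem (by exact mt h1.mp hy1)]
    simp

/-! ### The Bergman kernel and moments -/

/-- The integral of `f` against the reproducing kernel `(1 - w̄ z)⁻²` of the Bergman space, as a
function of `z`. Only its values in the unit disk are meaningful. -/
noncomputable def bergmanIntegral (f : ℂ → ℂ) (z : ℂ) : ℂ :=
  ∫ w, f w / (1 - conj w * z) ^ 2 ∂diskArea

/-- The moment of `f` against the `n`-th conjugate monomial. -/
noncomputable def diskMoment (f : ℂ → ℂ) (n : ℕ) : ℂ := ∫ w, conj w ^ n * f w ∂diskArea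

lemma bergmanIntegral_congr_ae {f g : ℂ → ℂ} (h : f =ᵐ[diskArea] g) :
    bergmanIntegral f = bergmanIntegral g := by
  funext z
  exact integral_congr_ae (h.mono fun w hw => by simp only [hw])

lemma diskMoment_congr_ae {f g : ℂ → ℂ} (h : f =ᵐ[diskArea] g) (n : ℕ) :
    diskMoment f n = diskMoment g n :=
  integral_congr_ae (h.mono fun w hw => by simp only [hw])

lemma norm_diskMoment_le {f : ℂ → ℂ} (hf : Integrable f diskArea) (n : ℕ) :
    ‖diskMoment f n‖ ≤ ∫ w, ‖f w‖ ∂diskArea := by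
  refine norm_integral_le_of_norm_le hf.norm ?_
  filter_upwards [ae_diskArea_mem] with w hw
  rw [norm_mul, norm_pow, RCLike.norm_conj]
  exact mul_le_of_le_one_left (norm_nonneg _)
    (pow_le_one₀ (norm_nonneg w) (mem_ball_zero_iff.mp hw).le)

lemma hasSum_inv_one_sub_sq {ζ : ℂ} (hζ : ‖ζ‖ < 1) :
    HasSum (fun n : ℕ => ((n : ℂ) + 1) * ζ ^ n) (1 / (1 - ζ) ^ 2) := by
  have := hasSum_choose_mul_geometric_of_norm_lt_one 1 hζ
  simpa using this

lemma summable_add_one_mul_pow {r : ℝ} (h0 : 0 ≤ r) (hr : r < 1) :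
    Summable fun n : ℕ => ((n : ℝ) + 1) * r ^ n := by
  have := (hasSum_choose_mul_geometric_of_norm_lt_one 1
    (show ‖r‖ < 1 by rwa [Real.norm_of_nonneg h0])).summable
  simpa using this

/-- The Bergman integral as a power series whose coefficients are the moments. -/
lemma hasSum_bergmanIntegral {f : ℂ → ℂ} (hf : Integrable f diskArea) {z : ℂ} (hz : ‖z‖ < 1) :
    HasSum (fun n : ℕ => ((n : ℂ) + 1) * diskMoment f n * z ^ n) (bergmanIntegral f z) := by
  have h1 : ∀ n : ℕ, ∫ w, ((n : ℂ) + 1) * (conj w * z) ^ n * f w ∂diskArea =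
      ((n : ℂ) + 1) * diskMoment f n * z ^ n := fun n => by
    rw [diskMoment, mul_assoc, ← integral_mul_const, ← integral_const_mul]
    congr 1 with w
    ring
  simp only [← h1]
  have hsum := summable_add_one_mul_pow (norm_nonneg z) hz
  refine hasSum_integral_of_dominated_convergence (fun n w => ((n : ℝ) + 1) * ‖z‖ ^ n * ‖f w‖)
    (fun n => ?_) (fun n => ?_) ?_ ?_ ?_
  · exact (by fun_prop : Measurable fun w : ℂ => ((n : ℂ) + 1) * (conj w * z) ^ n)
      |>.aestronglyMeasurable.mul hf.aestronglyMeasurable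
  · filter_upwards [ae_diskArea_mem] with w hw
    have hw' : ‖w‖ ≤ 1 := (mem_ball_zero_iff.mp hw).le
    rw [norm_mul, norm_mul, norm_pow, norm_mul, RCLike.norm_conj]
    have h2 : ‖(n : ℂ) + 1‖ = (n : ℝ) + 1 := by
      exact_mod_cast Complex.norm_natCast (n + 1)
    rw [h2]
    gcongr
    exact mul_le_of_le_one_left (norm_nonneg _) hw'
  · exact Eventually.of_forall fun w => hsum.mul_right _
  · simp only [tsum_mul_right]
    exact hf.norm.const_mul _
  · filter_upwards [ae_diskArea_mem] with w hw
    have hζ : ‖conj w * z‖ < 1 := by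
      rw [norm_mul, RCLike.norm_conj]
      exact mul_lt_one_of_nonneg_of_lt_one_left (norm_nonneg _) (mem_ball_zero_iff.mp hw) hz.le
    have := (hasSum_inv_one_sub_sq hζ).mul_right (f w)
    rwa [one_div_mul_eq_div] at this

lemma differentiableOn_bergmanIntegral {f : ℂ → ℂ} (hf : Integrable f diskArea) :
    DifferentiableOn ℂ (bergmanIntegral f) (Metric.ball 0 1) := by
  intro z hz
  obtain ⟨r, hzr, hr1⟩ := exists_between (mem_ball_zero_iff.mp hz)
  have hr0 : 0 ≤ r := (norm_nonneg z).trans hzr.le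
  have hd : DifferentiableOn ℂ (fun z => ∑' n : ℕ, ((n : ℂ) + 1) * diskMoment f n * z ^ n)
      (Metric.ball 0 r) := by
    refine Complex.differentiableOn_tsum_of_summable_norm
      ((summable_add_one_mul_pow hr0 hr1).mul_right (∫ w, ‖f w‖ ∂diskArea))
      (fun n => by fun_prop) Metric.isOpen_ball fun n w hw => ?_
    have h2 : ‖(n : ℂ) + 1‖ = (n : ℝ) + 1 := by
      exact_mod_cast Complex.norm_natCast (n + 1)
    rw [norm_mul, norm_mul, norm_pow, h2, mul_right_comm]
    gcongr
    · exact (mem_ball_zero_iff.mp hw).le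
    · exact norm_diskMoment_le hf n
  have hzr' : Metric.ball (0 : ℂ) r ∈ 𝓝 z :=
    Metric.isOpen_ball.mem_nhds (mem_ball_zero_iff.mpr hzr)
  have heq : bergmanIntegral f =ᶠ[𝓝 z]
      fun z => ∑' n : ℕ, ((n : ℂ) + 1) * diskMoment f n * z ^ n := by
    filter_upwards [hzr'] with w hw
    exact (hasSum_bergmanIntegral hf ((mem_ball_zero_iff.mp hw).trans hr1)).tsum_eq.symm
  exact ((hd.differentiableAt hzr').congr_of_eventuallyEq heq).differentiableWithinAt

/-- The moments of an analytic function restricted to a smaller disk. -/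
lemma integral_indicator_ball_mul_of_hasSum {g : ℂ → ℂ} {a : ℕ → ℂ}
    (hg : ∀ z : ℂ, ‖z‖ < 1 → HasSum (fun n => a n * z ^ n) (g z)) (n : ℕ) {r : ℝ} (hr0 : 0 ≤ r)
    (hr : r < 1) :
    ∫ w, (Metric.ball (0 : ℂ) r).indicator (fun w => conj w ^ n * g w) w ∂diskArea =
      a n * (r ^ (2 * n + 2) / (n + 1) : ℝ) := by
  let F : ℝ → ℂ := (Set.Iio r).indicator 1
  have hF : ∀ y, ‖F y‖ ≤ 1 := fun y => by
    by_cases hy : y < r <;> simp [F, hy]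
  have hFm : Measurable F := measurable_one.indicator measurableSet_Iio
  have hself : ∫ w, F ‖w‖ * (conj w ^ n * w ^ n) ∂diskArea = (r ^ (2 * n + 2) / (n + 1) : ℝ) := by
    rw [integral_radial_mul_monomial_self]
    have : ∀ y : ℝ, ((y ^ (2 * n + 1) : ℝ) : ℂ) * F y =
        (Set.Iio r).indicator (fun y => ((y ^ (2 * n + 1) : ℝ) : ℂ)) y := fun y => by
      by_cases hy : y < r <;> simp [F, hy]
    simp only [this]
    rw [setIntegral_indicator measurableSet_Iio, Set.Ioo_inter_Iio, min_eq_right hr.le,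
      integral_Ioo_pow _ hr0]
    have h0 : (n : ℂ) + 1 ≠ 0 := by exact_mod_cast n.succ_ne_zero
    have h2 : ((2 * n + 1 : ℕ) : ℝ) + 1 = 2 * (n + 1) := by push_cast; ring
    rw [h2]
    push_cast
    field_simp
  have hsum : Summable fun m => ‖a m‖ * r ^ m := by
    have := (hg (r : ℂ) (by simpa [abs_of_nonneg hr0] using hr)).summable.norm
    simpa [abs_of_nonneg hr0] using this
  have hs : HasSum (fun m => ∫ w, a m * (F ‖w‖ * (conj w ^ n * w ^ m)) ∂diskArea)
      (∫ w, (Metric.ball (0 : ℂ) r).indicator (fun w => conj w ^ n * g w) w ∂diskArea) := by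
    refine hasSum_integral_of_dominated_convergence (fun m _ => ‖a m‖ * r ^ m)
      (fun m => ?_) (fun m => ?_) (Eventually.of_forall fun _ => hsum) (integrable_const _) ?_
    · exact Measurable.aestronglyMeasurable (by fun_prop)
    · filter_upwards [ae_diskArea_mem] with w hw
      have hw' : ‖w‖ ≤ 1 := (mem_ball_zero_iff.mp hw).le
      rw [norm_mul, norm_mul, norm_mul, norm_pow, norm_pow, RCLike.norm_conj]
      by_cases hwr : ‖w‖ < r
      · gcongr
        calc ‖F ‖w‖‖ * (‖w‖ ^ n * ‖w‖ ^ m) ≤ 1 * (1 * r ^ m) := by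
              gcongr
              · exact hF _
              · exact pow_le_one₀ (norm_nonneg _) hw'
          _ = r ^ m := by ring
      · have : F ‖w‖ = 0 := by simp [F, hwr]
        rw [this, norm_zero, zero_mul, mul_zero]
        positivity
    · filter_upwards [ae_diskArea_mem] with w hw
      by_cases hwr : ‖w‖ < r
      · have := (hg w (mem_ball_zero_iff.mp hw)).mul_left (conj w ^ n)
        rw [Set.indicator_of_mem (mem_ball_zero_iff.mpr hwr)]
        convert! this using 2 with m
        simp [F, hwr]
        ring
      · rw [Set.indicator_of_notMem (by simpa using hwr)]
        simp [F, hwr, hasSum_zero]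
  refine hs.unique ?_
  convert! hasSum_ite_eq n (a n * (r ^ (2 * n + 2) / (n + 1) : ℝ)) using 2 with m
  rw [integral_const_mul]
  split_ifs with h
  · subst h; rw [hself]
  · rw [integral_radial_mul_monomial_of_ne F (Ne.symm h), mul_zero]

/-- The moments of an integrable analytic function are its Taylor coefficients up to the factor
`n + 1`, as the limit of the moments over the disks of radius `r < 1`. -/
lemma diskMoment_of_hasSum {g : ℂ → ℂ} (hgi : Integrable g diskArea) {a : ℕ → ℂ}
    (hg : ∀ z : ℂ, ‖z‖ < 1 → HasSum (fun n => a n * z ^ n) (g z)) (n : ℕ) :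
    ((n : ℂ) + 1) * diskMoment g n = a n := by
  let r : ℕ → ℝ := fun k => k / (k + 1)
  have hr0 : ∀ k, 0 ≤ r k := fun k => by positivity
  have hr1 : ∀ k, r k < 1 := fun k => by
    rw [div_lt_one (by positivity)]; linarith
  have hr : Tendsto r atTop (𝓝 1) := tendsto_natCast_div_add_atTop 1
  have h1 : Tendsto (fun k => ∫ w, (Metric.ball (0 : ℂ) (r k)).indicator
      (fun w => conj w ^ n * g w) w ∂diskArea) atTop (𝓝 (diskMoment g n)) := by
    refine tendsto_integral_of_dominated_convergence (fun w => ‖g w‖) (fun k => ?_) hgi.norm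
      (fun k => ?_) ?_
    · exact ((by fun_prop : Measurable fun w : ℂ => conj w ^ n).aestronglyMeasurable.mul
        hgi.aestronglyMeasurable).indicator measurableSet_ball
    · filter_upwards [ae_diskArea_mem] with w hw
      refine (norm_indicator_le_norm_self _ _).trans ?_
      rw [norm_mul, norm_pow, RCLike.norm_conj]
      exact mul_le_of_le_one_left (norm_nonneg _)
        (pow_le_one₀ (norm_nonneg w) (mem_ball_zero_iff.mp hw).le)
    · filter_upwards [ae_diskArea_mem] with w hw
      refine tendsto_const_nhds.congr' ?_
      filter_upwards [hr.eventually (lt_mem_nhds (mem_ball_zero_iff.mp hw))] with k hk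
      rw [Set.indicator_of_mem (mem_ball_zero_iff.mpr hk)]
  have h2 : Tendsto (fun k => a n * ((r k ^ (2 * n + 2) / (n + 1) : ℝ) : ℂ)) atTop
      (𝓝 (a n * ((1 ^ (2 * n + 2) / (n + 1) : ℝ) : ℂ))) :=
    ((Complex.continuous_ofReal.tendsto _).comp ((hr.pow _).div_const _)).const_mul _
  have h3 := tendsto_nhds_unique h1 (h2.congr fun k =>
    (integral_indicator_ball_mul_of_hasSum hg n (hr0 k) (hr1 k)).symm)
  rw [h3]
  have : (n : ℂ) + 1 ≠ 0 := by exact_mod_cast n.succ_ne_zero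
  push_cast
  field_simp
  simp

/-- The reproducing property of the Bergman kernel. -/
lemma bergmanIntegral_eq_self {g : ℂ → ℂ} (hgi : Integrable g diskArea)
    (hg : DifferentiableOn ℂ g (Metric.ball 0 1)) {z : ℂ} (hz : ‖z‖ < 1) :
    bergmanIntegral g z = g z := by
  have hs : ∀ z : ℂ, ‖z‖ < 1 →
      HasSum (fun n => ((n.factorial : ℂ)⁻¹ * iteratedDeriv n g 0) * z ^ n) (g z) := by
    intro z hz
    have := Complex.hasSum_taylorSeries_on_ball hg (mem_ball_zero_iff.mpr hz)
    simpa [mul_assoc, mul_comm, mul_left_comm] using this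
  have h := hasSum_bergmanIntegral hgi hz
  simp only [diskMoment_of_hasSum hgi hs] at h
  exact h.unique (hs z hz)

/-! ### The Bergman space and its Toeplitz operators -/

lemma integrable_coeFn_Lp_two (h : Lp ℂ 2 diskArea) : Integrable h diskArea :=
  (Lp.memLp h).integrable one_le_two

lemma mem_bergmanSubmodule_iff (h : Lp ℂ 2 diskArea) :
    h ∈ bergmanSubmodule ↔ h =ᵐ[diskArea] bergmanIntegral h := by
  constructor
  · rintro ⟨g, hg, hgh⟩
    rw [bergmanIntegral_congr_ae hgh]
    filter_upwards [hgh, ae_diskArea_mem] with z hz hz1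
    rw [hz, bergmanIntegral_eq_self ((integrable_coeFn_Lp_two h).congr hgh) hg
      (mem_ball_zero_iff.mp hz1)]
  · exact fun hh => ⟨_, differentiableOn_bergmanIntegral (integrable_coeFn_Lp_two h), hh⟩

lemma memLp_bergmanKernel {z : ℂ} (hz : ‖z‖ < 1) :
    MemLp (fun w : ℂ => 1 / (1 - conj z * w) ^ 2) 2 diskArea := by
  refine MemLp.of_bound (by fun_prop : Measurable _).aestronglyMeasurable
    (1 / (1 - ‖z‖) ^ 2) ?_
  filter_upwards [ae_diskArea_mem] with w hw
  have h1 : 0 < 1 - ‖z‖ := by linarith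
  rw [norm_div, norm_one, norm_pow]
  gcongr
  calc 1 - ‖z‖ ≤ ‖(1 : ℂ)‖ - ‖conj z * w‖ := by
        rw [norm_one, norm_mul, RCLike.norm_conj]
        have := mul_le_of_le_one_right (norm_nonneg z) (mem_ball_zero_iff.mp hw).le
        linarith
    _ ≤ _ := norm_sub_norm_le _ _

lemma bergmanIntegral_eq_inner {z : ℂ} (hz : ‖z‖ < 1) (h : Lp ℂ 2 diskArea) :
    bergmanIntegral h z = inner ℂ ((memLp_bergmanKernel hz).toLp _) h := by
  rw [L2.inner_def]
  refine integral_congr_ae ?_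
  filter_upwards [(memLp_bergmanKernel hz).coeFn_toLp] with w hw
  rw [hw, RCLike.inner_apply]
  simp [div_eq_mul_inv, mul_comm]

lemma continuous_bergmanIntegral {z : ℂ} (hz : ‖z‖ < 1) :
    Continuous fun h : Lp ℂ 2 diskArea => bergmanIntegral h z := by
  simp only [bergmanIntegral_eq_inner hz]
  fun_prop

/-- The Bergman space is closed in `L²`: it consists of the `h` that agree almost everywhere with
their Bergman integral, and for `z` in the disk the latter depends continuously on `h`. -/
lemma isClosed_bergmanSubmodule : IsClosed (bergmanSubmodule : Set (Lp ℂ 2 diskArea)) := by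
  refine isClosed_of_closure_subset fun h hh => ?_
  obtain ⟨u, hu, hlim⟩ := mem_closure_iff_seq_limit.mp hh
  obtain ⟨ns, hns, hae⟩ := (tendstoInMeasure_of_tendsto_Lp hlim).exists_seq_tendsto_ae
  rw [SetLike.mem_coe, mem_bergmanSubmodule_iff]
  filter_upwards [hae, ae_diskArea_mem,
    ae_all_iff.mpr fun k => (mem_bergmanSubmodule_iff (u k)).mp (hu k)] with z hz hz1 hk
  refine tendsto_nhds_unique hz ?_
  simp only [hk]
  exact ((continuous_bergmanIntegral (mem_ball_zero_iff.mp hz1)).tendsto h).comp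
    (hlim.comp hns.tendsto_atTop)

instance : CompleteSpace bergmanSubmodule :=
  isClosed_bergmanSubmodule.completeSpace_coe

instance : CompleteSpace Bergman := inferInstanceAs (CompleteSpace bergmanSubmodule)

lemma coeFn_bergmanBasis (n : ℕ) :
    bergmanBasis n =ᵐ[diskArea] fun z : ℂ => (Real.sqrt (n + 1) : ℂ) * z ^ n :=
  (memLp_basisFun n).coeFn_toLp

lemma inner_bergmanBasis (n : ℕ) (h : Lp ℂ 2 diskArea) :
    inner ℂ (Bergman.incl (bergmanBasis n)) h = (Real.sqrt (n + 1) : ℂ) * diskMoment h n := by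
  rw [L2.inner_def, diskMoment, ← integral_const_mul]
  refine integral_congr_ae ?_
  filter_upwards [coeFn_bergmanBasis n] with w hw
  rw [hw, RCLike.inner_apply, map_mul, map_pow, Complex.conj_ofReal]
  ring

lemma diskMoment_radial_mul_bergmanBasis (F : ℝ → ℂ) (m n : ℕ) :
    diskMoment (fun w => F ‖w‖ * bergmanBasis n w) m =
      if m = n then (Real.sqrt (n + 1) : ℂ) * (2 * ∫ y in Set.Ioo (0 : ℝ) 1,
        (y ^ (2 * n + 1) : ℝ) * F y) else 0 := by
  have h : diskMoment (fun w => F ‖w‖ * bergmanBasis n w) m =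
      (Real.sqrt (n + 1) : ℂ) * ∫ w, F ‖w‖ * (conj w ^ m * w ^ n) ∂diskArea := by
    rw [diskMoment, ← integral_const_mul]
    refine integral_congr_ae ?_
    filter_upwards [coeFn_bergmanBasis n] with w hw
    rw [hw]
    ring
  rw [h]
  split_ifs with hmn
  · subst hmn
    rw [integral_radial_mul_monomial_self]
  · rw [integral_radial_mul_monomial_of_ne F hmn, mul_zero]

lemma sqrt_mul_sqrt_natCast_add_one (n : ℕ) :
    (Real.sqrt (n + 1) : ℂ) * Real.sqrt (n + 1) = n + 1 := by
  exact_mod_cast Real.mul_self_sqrt (by positivity : (0 : ℝ) ≤ (n : ℝ) + 1)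

lemma orthonormal_bergmanBasis : Orthonormal ℂ bergmanBasis := by
  rw [orthonormal_iff_ite]
  intro m n
  rw [← Bergman.incl.inner_map_map, inner_bergmanBasis]
  have h := diskMoment_radial_mul_bergmanBasis 1 m n
  simp only [Pi.one_apply, one_mul, mul_one] at h
  rw [h]
  split_ifs with hmn
  · subst hmn
    rw [integral_Ioo_pow _ zero_le_one, ← mul_assoc, sqrt_mul_sqrt_natCast_add_one]
    have h0 : (m : ℂ) + 1 ≠ 0 := by exact_mod_cast m.succ_ne_zero
    have h2 : ((2 * m + 1 : ℕ) : ℝ) + 1 = 2 * (m + 1) := by push_cast; ring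
    rw [h2]
    push_cast
    field_simp
    simp
  · rw [mul_zero]

lemma diskMoment_eq_zero_of_inner_eq_zero {h : Lp ℂ 2 diskArea} {n : ℕ}
    (hn : inner ℂ (Bergman.incl (bergmanBasis n)) h = 0) : diskMoment h n = 0 := by
  rw [inner_bergmanBasis] at hn
  have : (Real.sqrt (n + 1) : ℂ) ≠ 0 := by
    exact_mod_cast (Real.sqrt_pos.mpr (by positivity : (0 : ℝ) < (n : ℝ) + 1)).ne'
  exact (mul_eq_zero.mp hn).resolve_left this

lemma bergmanIntegral_eq_zero_of_inner_eq_zero {h : Lp ℂ 2 diskArea}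
    (hh : ∀ n, inner ℂ (Bergman.incl (bergmanBasis n)) h = 0) {z : ℂ} (hz : ‖z‖ < 1) :
    bergmanIntegral h z = 0 := by
  have := hasSum_bergmanIntegral (integrable_coeFn_Lp_two h) hz
  simp only [diskMoment_eq_zero_of_inner_eq_zero (hh _), mul_zero, zero_mul] at this
  exact this.unique hasSum_zero

lemma Bergman.coeFn_eq_bergmanIntegral (f : Bergman) :
    f =ᵐ[diskArea] bergmanIntegral f :=
  (mem_bergmanSubmodule_iff (Bergman.incl f)).mp (Subtype.property (p := (· ∈ bergmanSubmodule)) f)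

lemma Bergman.ext_ae {f g : Bergman} (h : f =ᵐ[diskArea] g) : f = g :=
  Bergman.incl.injective (Lp.ext h)

/-- The standard orthonormal base of the Bergman space, as a Hilbert basis. It is total since the
Bergman integral of `f`, which is `f` itself, is determined by the moments of `f`. -/
noncomputable def bergmanHilbertBasis : HilbertBasis ℕ ℂ Bergman :=
  HilbertBasis.mkOfOrthogonalEqBot orthonormal_bergmanBasis (by
    rw [Submodule.eq_bot_iff]
    intro f hf
    refine Bergman.ext_ae ?_
    filter_upwards [f.coeFn_eq_bergmanIntegral, ae_diskArea_mem,
      Lp.coeFn_zero ℂ 2 diskArea] with z hz hz1 h0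
    rw [hz, map_zero, h0]
    refine bergmanIntegral_eq_zero_of_inner_eq_zero (fun n => ?_) (mem_ball_zero_iff.mp hz1)
    rw [Bergman.incl.inner_map_map]
    exact Submodule.mem_orthogonal _ _ |>.mp hf _ (Submodule.subset_span ⟨n, rfl⟩))

lemma coe_bergmanHilbertBasis (n : ℕ) : bergmanHilbertBasis n = bergmanBasis n := by
  simp [bergmanHilbertBasis]

/-- The orthogonal projection of `L²` onto the Bergman space. -/
noncomputable def bergmanProjection : Lp ℂ 2 diskArea →L[ℂ] Bergman :=
  bergmanSubmodule.orthogonalProjectionOnto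

/-- The orthogonal projection onto the Bergman space is given by the Bergman kernel. -/
lemma coeFn_bergmanProjection (h : Lp ℂ 2 diskArea) :
    bergmanProjection h =ᵐ[diskArea] bergmanIntegral h := by
  set f := bergmanProjection h with hf
  filter_upwards [f.coeFn_eq_bergmanIntegral, ae_diskArea_mem] with z hz hz1
  have hz' := mem_ball_zero_iff.mp hz1
  rw [hz]
  -- `h - f` is orthogonal to the base, so it has the Bergman integral `0`
  have h0 : bergmanIntegral (h - Bergman.incl f : Lp ℂ 2 diskArea) z = 0 :=
    bergmanIntegral_eq_zero_of_inner_eq_zero (fun n =>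
      Submodule.sub_starProjection_mem_orthogonal (K := bergmanSubmodule) h _
        (Subtype.property (p := (· ∈ bergmanSubmodule)) (bergmanBasis n))) hz'
  rw [bergmanIntegral_eq_inner hz', inner_sub_right, sub_eq_zero, ← bergmanIntegral_eq_inner hz',
    ← bergmanIntegral_eq_inner hz'] at h0
  exact h0.symm

/-- The Toeplitz operator with symbol `a`, as the compression of the multiplication by `a`. -/
noncomputable def toeplitz (a : Lp ℂ ∞ diskArea) : Bergman →L[ℂ] Bergman :=
  bergmanProjection ∘L (ContinuousLinearMap.mul ℂ ℂ).holderL diskArea ∞ 2 2 a ∘L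
    Bergman.incl.toContinuousLinearMap

lemma coeFn_toeplitz (a : Lp ℂ ∞ diskArea) (f : Bergman) :
    toeplitz a f =ᵐ[diskArea] bergmanIntegral fun w => a w * f w := by
  refine (coeFn_bergmanProjection _).trans (Eventually.of_forall fun z => ?_)
  refine congrFun (bergmanIntegral_congr_ae ?_) z
  exact (ContinuousLinearMap.mul ℂ ℂ).coeFn_holder (r := 2) a (Bergman.incl f)

lemma isToeplitz_toeplitz (a : Lp ℂ ∞ diskArea) : IsToeplitz a (toeplitz a) :=
  fun f => coeFn_toeplitz a f

/-- A Toeplitz operator with radial symbol is diagonal; the substitution `t = y ^ (2n + 2)`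
brings its eigenvalues to the stated form. -/
lemma toeplitz_radial_bergmanBasis {a : Lp ℂ ∞ diskArea} {F : ℝ → ℂ}
    (ha : a =ᵐ[diskArea] fun w => F ‖w‖) (n : ℕ) :
    toeplitz a (bergmanBasis n) =
      (∫ t in Set.Ioo (0 : ℝ) 1, F (t ^ ((2 * n + 2 : ℝ)⁻¹))) • bergmanBasis n := by
  refine Bergman.ext_ae ?_
  have hint : Integrable (fun w => a w * bergmanBasis n w) diskArea := by
    have := integrable_coeFn_Lp_two ((ContinuousLinearMap.mul ℂ ℂ).holder (r := 2) a
      (Bergman.incl (bergmanBasis n)))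
    exact this.congr ((ContinuousLinearMap.mul ℂ ℂ).coeFn_holder (r := 2) a _)
  have hae : (fun w => a w * bergmanBasis n w) =ᵐ[diskArea]
      fun w => F ‖w‖ * bergmanBasis n w := ha.mono fun w hw => by simp only [hw]
  have hsmul := Lp.coeFn_smul (∫ t in Set.Ioo (0 : ℝ) 1, F (t ^ ((2 * n + 2 : ℝ)⁻¹)))
    (Bergman.incl (bergmanBasis n))
  rw [map_smul]
  filter_upwards [coeFn_toeplitz a (bergmanBasis n), ae_diskArea_mem, hsmul,
    coeFn_bergmanBasis n] with z hz hz1 h2 h3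
  rw [hz, h2, Pi.smul_apply, h3, smul_eq_mul, ← integral_pow_mul_eq]
  refine (hasSum_bergmanIntegral hint (mem_ball_zero_iff.mp hz1)).unique ?_
  suffices h : ∀ m : ℕ, ((m : ℂ) + 1) * diskMoment (fun w => a w * bergmanBasis n w) m * z ^ m =
      if m = n then (2 * (n + 1) * ∫ y in Set.Ioo (0 : ℝ) 1, (y ^ (2 * n + 1) : ℝ) * F y) *
        ((Real.sqrt (n + 1) : ℂ) * z ^ n) else 0 by
    simp only [h]
    exact hasSum_ite_eq n _
  intro m
  rw [diskMoment_congr_ae hae, diskMoment_radial_mul_bergmanBasis]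
  split_ifs with h
  · subst h
    ring
  · simp

/-! ### Slowly varying symbols -/

lemma MapClusterPt.of_tendsto_sub {c q : ℕ → ℂ} {z : ℂ} (h : MapClusterPt z atTop c)
    (hcq : Tendsto (fun n => c n - q n) atTop (𝓝 0)) : MapClusterPt z atTop q := by
  rw [Metric.nhds_basis_ball.mapClusterPt_iff_frequently] at h ⊢
  intro ε hε
  have hev := Metric.tendsto_nhds.mp hcq (ε / 2) (by positivity)
  refine ((h (ε / 2) (by positivity)).and_eventually hev).mono fun n hn => ?_
  have h1 := Metric.mem_ball.mp hn.1
  have h2 := hn.2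
  rw [dist_zero_right, ← dist_eq_norm, dist_comm] at h2
  rw [Metric.mem_ball]
  linarith [dist_triangle (q n) (c n) z]

lemma abs_sqrt_sub_sqrt_sub_le_one {x s : ℝ} (hx : s ^ 2 ≤ x) : |√x - √(x - s)| ≤ 1 := by
  have hx0 : 0 ≤ x := (sq_nonneg s).trans hx
  have hs : |s| ≤ √x := Real.abs_le_sqrt hx
  have ha := Real.sqrt_nonneg x
  have hb := Real.sqrt_nonneg (x - s)
  have ha2 := Real.sq_sqrt hx0
  obtain ⟨h1, h2⟩ := abs_le.mp hs
  rcases lt_or_ge (x - s) 0 with h | h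
  · rw [Real.sqrt_eq_zero_of_nonpos h.le, sub_zero, abs_of_nonneg ha]
    nlinarith
  · have hb2 := Real.sq_sqrt h
    rw [abs_le]
    constructor <;> nlinarith

lemma tendsto_floor_sqrt : Tendsto (fun x : ℝ => ⌊√x⌋₊) atTop atTop :=
  tendsto_nat_floor_atTop.comp Real.tendsto_sqrt_atTop

/-- The step function `x ↦ p ⌊√x⌋₊` varies slowly: a bounded translation moves the index by at most
one once `x` is large. -/
lemma tendsto_slow_sub {p : ℕ → ℂ} (hp : Tendsto (fun k => dist (p k) (p (k + 1))) atTop (𝓝 0))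
    (s : ℝ) : Tendsto (fun x : ℝ => p ⌊√(x - s)⌋₊ - p ⌊√x⌋₊) atTop (𝓝 0) := by
  have hi : Tendsto (fun x : ℝ => ⌊√(x - s)⌋₊) atTop atTop :=
    tendsto_floor_sqrt.comp (tendsto_atTop_add_const_right _ (-s) tendsto_id)
  have hlim := (hp.comp hi).add (hp.comp tendsto_floor_sqrt)
  rw [add_zero] at hlim
  refine squeeze_zero_norm' ?_ hlim
  filter_upwards [eventually_ge_atTop (s ^ 2)] with x hx
  have hfl : ∀ {a b : ℝ}, 0 ≤ b → a ≤ b + 1 → ⌊a⌋₊ ≤ ⌊b⌋₊ + 1 := fun hb hab => by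
    rw [← Nat.floor_add_one hb]
    exact Nat.floor_le_floor hab
  obtain ⟨h1, h2⟩ := abs_le.mp (abs_sqrt_sub_sqrt_sub_le_one hx)
  have h3 := hfl (Real.sqrt_nonneg x) (by linarith : √(x - s) ≤ √x + 1)
  have h4 := hfl (Real.sqrt_nonneg (x - s)) (by linarith : √x ≤ √(x - s) + 1)
  simp only [Function.comp_apply]
  generalize ⌊√(x - s)⌋₊ = i at *
  generalize ⌊√x⌋₊ = j at *
  rw [← dist_eq_norm]
  have hcases : i = j ∨ i = j + 1 ∨ j = i + 1 := by omega
  rcases hcases with rfl | rfl | rfl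
  · rw [dist_self]; positivity
  · rw [dist_comm]; exact le_add_of_nonneg_left dist_nonneg
  · exact le_add_of_nonneg_right dist_nonneg

lemma neg_log_neg_log_rpow {t r : ℝ} (ht0 : 0 < t) (ht1 : t < 1) (hr : 0 < r) :
    -Real.log (-Real.log (t ^ r⁻¹)) = Real.log r - Real.log (-Real.log t) := by
  have hl : 0 < -Real.log t := neg_pos.mpr (Real.log_neg ht0 ht1)
  rw [Real.log_rpow ht0, ← mul_neg, Real.log_mul (inv_pos.mpr hr).ne' hl.ne', Real.log_inv]
  ring

lemma tendsto_log_two_mul_add_two : Tendsto (fun n : ℕ => Real.log (2 * n + 2)) atTop atTop := by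
  refine Real.tendsto_log_atTop.comp (tendsto_atTop_add_const_right _ _ ?_)
  exact tendsto_natCast_atTop_atTop.const_mul_atTop two_pos

/-- Each index is attained by `⌊√(log (2n + 2))⌋₊` since the latter grows slowly. -/
lemma exists_floor_sqrt_log_eq {k : ℕ} (hk : 1 ≤ k) :
    ∃ n : ℕ, k ≤ n ∧ ⌊√(Real.log (2 * n + 2))⌋₊ = k := by
  -- `exp (k ^ 2) ≤ 2n + 2 < 8 exp (k ^ 2) ≤ exp ((k + 1) ^ 2)`, since `8 ≤ exp 3 ≤ exp (2k + 1)`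
  set n := ⌈Real.exp ((k : ℝ) ^ 2)⌉₊ with hn
  have hk' : (1 : ℝ) ≤ k := by exact_mod_cast hk
  have h1 : Real.exp ((k : ℝ) ^ 2) ≤ n := Nat.le_ceil _
  have h2 : (n : ℝ) < Real.exp ((k : ℝ) ^ 2) + 1 := Nat.ceil_lt_add_one (Real.exp_pos _).le
  have hexp := Real.add_one_le_exp ((k : ℝ) ^ 2)
  have hpos := Real.exp_pos ((k : ℝ) ^ 2)
  refine ⟨n, ?_, ?_⟩
  · have : (k : ℝ) ≤ n := by nlinarith
    exact_mod_cast this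
  rw [Nat.floor_eq_iff (Real.sqrt_nonneg _)]
  constructor
  · refine Real.le_sqrt_of_sq_le ((Real.le_log_iff_exp_le (by positivity)).mpr ?_)
    linarith
  · rw [Real.sqrt_lt' (by positivity), Real.log_lt_iff_lt_exp (by positivity)]
    have h3 : ((k : ℝ) + 1) ^ 2 = (k : ℝ) ^ 2 + (2 * k + 1) := by ring
    rw [h3, Real.exp_add]
    have h4 : (8 : ℝ) ≤ Real.exp (2 * k + 1) := by
      calc (8 : ℝ) ≤ Real.exp 1 ^ 3 := by
            have := Real.exp_one_gt_d9
            calc (8 : ℝ) = 2 ^ 3 := by norm_num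
              _ ≤ _ := by gcongr; linarith
        _ = Real.exp 3 := by rw [← Real.exp_nat_mul]; norm_num
        _ ≤ _ := Real.exp_le_exp.mpr (by linarith)
    nlinarith

/-- The averages occurring as eigenvalues differ from a slowly varying sequence by a null
sequence. -/
lemma tendsto_integral_slow_sub {p : ℕ → ℂ} {C : ℝ} (hC : ∀ k, ‖p k‖ ≤ C)
    (hp : Tendsto (fun k => dist (p k) (p (k + 1))) atTop (𝓝 0)) :
    Tendsto (fun n : ℕ => (∫ t in Set.Ioo (0 : ℝ) 1,
        p ⌊√(-Real.log (-Real.log (t ^ ((2 * n + 2 : ℝ)⁻¹))))⌋₊) -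
      p ⌊√(Real.log (2 * n + 2))⌋₊) atTop (𝓝 0) := by
  have hpm : Measurable p := measurable_from_top
  have hmeas : ∀ n : ℕ, Measurable fun t : ℝ =>
      p ⌊√(-Real.log (-Real.log (t ^ ((2 * n + 2 : ℝ)⁻¹))))⌋₊ := fun n =>
    hpm.comp (Nat.measurable_floor.comp (by fun_prop))
  have hint : ∀ n : ℕ, (∫ t in Set.Ioo (0 : ℝ) 1,
        p ⌊√(-Real.log (-Real.log (t ^ ((2 * n + 2 : ℝ)⁻¹))))⌋₊) -
      p ⌊√(Real.log (2 * n + 2))⌋₊ = ∫ t in Set.Ioo (0 : ℝ) 1,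
        (p ⌊√(-Real.log (-Real.log (t ^ ((2 * n + 2 : ℝ)⁻¹))))⌋₊ -
          p ⌊√(Real.log (2 * n + 2))⌋₊) := fun n => by
    rw [integral_sub (Integrable.of_bound (hmeas n).aestronglyMeasurable C
      (Eventually.of_forall fun t => hC _)) (integrable_const _)]
    simp
  simp only [hint]
  rw [← integral_zero ℝ ℂ (μ := volume.restrict (Set.Ioo 0 1))]
  refine tendsto_integral_of_dominated_convergence (fun _ => C + C)
    (fun n => ((hmeas n).sub_const _).aestronglyMeasurable) (integrable_const _)
    (fun n => Eventually.of_forall fun t => (norm_sub_le _ _).trans (add_le_add (hC _) (hC _))) ?_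
  filter_upwards [ae_restrict_mem measurableSet_Ioo] with t ht
  refine ((tendsto_slow_sub hp (Real.log (-Real.log t))).comp
    tendsto_log_two_mul_add_two).congr fun n => ?_
  rw [Function.comp_apply, neg_log_neg_log_rpow ht.1 ht.2 (by positivity)]

theorem corollary4p5 (E : Set ℂ) (hne : E.Nonempty) (hcomp : IsCompact E) (hconn : IsConnected E) :
    ∃ S : Bergman →L[ℂ] Bergman,
      IsRadial S ∧ S ∈ toeplitzAlgebra ∧ essentialSpectrum S = E := by
  obtain ⟨p, hpE, hp, hcl⟩ := hconn.exists_seq_slow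
  obtain ⟨C, hC⟩ := hcomp.isBounded.exists_norm_le
  have hpC : ∀ k, ‖p k‖ ≤ C := fun k => hC _ (hpE k)
  let F : ℝ → ℂ := fun y => p ⌊√(-Real.log (-Real.log y))⌋₊
  have hFm : Measurable F :=
    (measurable_from_top : Measurable p).comp (Nat.measurable_floor.comp (by fun_prop))
  have hF : MemLp (fun w : ℂ => F ‖w‖) ∞ diskArea :=
    memLp_top_of_bound (hFm.comp measurable_norm).aestronglyMeasurable C
      (Eventually.of_forall fun w => hpC _)
  have hS := toeplitz_radial_bergmanBasis hF.coeFn_toLp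
  refine ⟨toeplitz (hF.toLp _), ⟨_, hS⟩, ?_, ?_⟩
  · exact Subalgebra.le_topologicalClosure _ (Algebra.subset_adjoin ⟨_, isToeplitz_toeplitz _⟩)
  ext z
  have hlim := tendsto_integral_slow_sub hpC hp
  rw [essentialSpectrum, Set.mem_ofPred_eq, not_isFredholm_sub_smul_id_iff bergmanHilbertBasis
    (fun n => by rw [coe_bergmanHilbertBasis]; exact hS n)]
  constructor
  · intro hz
    have hz' := hz.of_tendsto_sub hlim
    refine hcomp.isClosed.closure_subset (mem_closure_iff_nhds.mpr fun s hs => ?_)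
    obtain ⟨n, hn⟩ := (mapClusterPt_iff_frequently.mp hz' s hs).exists
    exact ⟨_, hn, hpE _⟩
  · intro hz
    refine MapClusterPt.of_tendsto_sub (c := fun n : ℕ => p ⌊√(Real.log (2 * n + 2))⌋₊) ?_ ?_
    · rw [mapClusterPt_iff_frequently]
      intro s hs
      rw [frequently_atTop]
      intro N
      obtain ⟨k, hk, hks⟩ := frequently_atTop.mp
        (mapClusterPt_iff_frequently.mp (hcl z hz) s hs) (N + 1)
      obtain ⟨n, hkn, hn⟩ := exists_floor_sqrt_log_eq (by omega : 1 ≤ k)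
      exact ⟨n, by omega, by rwa [hn]⟩
    · simpa only [neg_sub, neg_zero] using hlim.neg
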